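/- Theorem. Let $M$ be a matroid on a finite ground set $E$, and let $P(M)\subset\mathbb{R}^E$ be its independence polytope, that is, the convex hull of the indicator vectors $\sum_{e\in I}\chi_e$ of all independent sets $I$ of $M$. Call a lattice polytope $P\subset\mathbb{R}^d$ (a convex polytope with vertices in $\mathbb{Z}^d$) smooth if for every vertex $v$ of $P$ the primitive edge directions from $v$ (the primitive integer vectors pointing from $v$ along the edges of $P$ that contain $v$) are a part of a $\mathbb{Z}$-basis of $\mathbb{Z}^d$. Then $P(M)$, regarded as a lattice polytope with respect to $\mathbb{Z}^E\subset\mathbb{R}^E$, is smooth if and only if $M$ is a direct sum of finitely many (possibly zero) matroids, each of which is either a loop (the rank-zero matroid on one element) or a uniform matroid $U_{1,n}$ of rank one on $n\ge 1$ elements (the independent sets are the sets with at most one element). -/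

import Mathlib

/-- The integer points of `ℝ^d`, as the image of `ℤ^d` (coordinates indexed by `d`). -/
def latticeVector {d : Type*} (z : d → ℤ) : d → ℝ := fun i => (z i : ℝ)

/-- A lattice polytope in `ℝ^d`: the convex hull of finitely many points of `ℤ^d`. -/
def IsLatticePolytope {d : Type*} (P : Set (d → ℝ)) : Prop :=
  ∃ S : Finset (d → ℤ), P = convexHull ℝ (latticeVector '' (S : Set (d → ℤ)))

/-- The segment from `v` to `w` is an edge of the polytope `P`: a one-dimensional face, where
a face is the set of points of `P` that maximise some linear functional over `P`. -/
def IsEdge {d : Type*} (P : Set (d → ℝ)) (v w : d → ℝ) : Prop :=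
  v ≠ w ∧ IsExposed ℝ P (segment ℝ v w)

/-- A primitive vector of `ℤ^d`: the greatest common divisor of its coordinates is `1`. -/
def IsPrimitiveVector {d : Type*} (z : d → ℤ) : Prop :=
  ∀ k : ℤ, (∀ i, k ∣ z i) → IsUnit k

/-- The primitive edge directions of `P` from `v`: the primitive vectors of `ℤ^d` that point
from `v` along an edge of `P` with endpoint `v`. -/
def primitiveEdgeDirections {d : Type*} (P : Set (d → ℝ)) (v : d → ℝ) : Set (d → ℤ) :=
  {z | IsPrimitiveVector z ∧
    ∃ w, IsEdge P v w ∧ ∃ t : ℝ, 0 < t ∧ w - v = t • latticeVector z}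

/-- A smooth polytope: a lattice polytope in `ℝ^d` such that, for every vertex `v`, the primitive
edge directions from `v` are part of a `ℤ`-basis of `ℤ^d`. -/
def IsSmoothPolytope {d : Type*} (P : Set (d → ℝ)) : Prop :=
  IsLatticePolytope P ∧
    ∀ v ∈ P.extremePoints ℝ, ∃ b : Module.Basis d ℤ (d → ℤ),
      primitiveEdgeDirections P v ⊆ Set.range b

namespace Matroid

/-- The independence polytope of `M` in `ℝ^E`: the convex hull of the indicator vectors of the
independent sets. -/
def independencePolytope {α : Type*} (M : Matroid α) : Set (M.E → ℝ) :=
  convexHull ℝ {x | ∃ I, M.Indep I ∧ x = Set.indicator {e : M.E | (e : α) ∈ I} 1}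

/-- `N` is a uniform matroid of rank `r`: the ground set has at least `r` elements, and the
independent sets are exactly its subsets with at most `r` elements. -/
def IsUniformOfRank {α : Type*} (N : Matroid α) (r : ℕ) : Prop :=
  (r : ℕ∞) ≤ N.E.encard ∧ ∀ I, N.Indep I ↔ I ⊆ N.E ∧ I.encard ≤ r

/-- `N` is a loop: its ground set is a single element, which is a loop. -/
def IsSingleLoop {α : Type*} (N : Matroid α) : Prop :=
  ∃ e, N = loopyOn {e}

end Matroid

/-! Both conditions are equivalent to every circuit having at most two elements.

If a circuit `C` contains distinct `x`, `y`, `z`, then edges leave the vertex `C \ {x}` in the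
directions `-e_y`, `-e_z`, `e_x - e_y`, `e_x - e_z`. The relation `(-e_y) + (e_x - e_z) = (e_x -
e_y) + (-e_z)` keeps them from being part of a basis
(`IsCircuit.encard_le_two_of_isSmoothPolytope`). When all circuits have size at most two, dependence
is detected inside loops and parallel classes, so `M` is the direct sum of these.

Conversely, for such a sum the polytope is a product of simplices and points. An edge changes a
vertex in one block only (`eq_exchange_of_isEdge`), and the resulting directions lie among the
columns of a unimodular involution (`fiberReflection`). -/

/-! ### Exposed segments, edges and primitive vectors -/

lemma isExposed_convexHull_segment {E : Type*} [TopologicalSpace E] [AddCommGroup E] [Module ℝ E]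
    {S : Set E} {v w : E} (hv : v ∈ S) (hw : w ∈ S) (l : StrongDual ℝ E) (m : ℝ)
    (hle : ∀ x ∈ S, l x ≤ m) (heq : ∀ x ∈ S, l x = m ↔ x = v ∨ x = w) :
    IsExposed ℝ (convexHull ℝ S) (segment ℝ v w) := by
  intro _
  refine ⟨l, ?_⟩
  have hvm : l v = m := (heq v hv).2 (Or.inl rfl)
  have hwm : l w = m := (heq w hw).2 (Or.inr rfl)
  have hseg : ∀ x ∈ segment ℝ v w, l x = m := by
    rintro x ⟨a, b, -, -, hab, rfl⟩
    simp only [map_add, map_smul, smul_eq_mul, hvm, hwm]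
    rw [← add_mul, hab, one_mul]
  -- The right-hand side is convex and contains `S`, so no explicit convex combinations are needed.
  have hcover : convexHull ℝ S ⊆ {x | l x < m} ∪ segment ℝ v w := by
    refine convexHull_min (fun x hx ↦ ?_) ?_
    · rcases (hle x hx).lt_or_eq with h | h
      · exact Or.inl h
      · rcases (heq x hx).1 h with rfl | rfl
        · exact Or.inr (left_mem_segment ℝ _ _)
        · exact Or.inr (right_mem_segment ℝ _ _)
    · rw [convex_iff_forall_pos]
      have hle' : ∀ x ∈ {x | l x < m} ∪ segment ℝ v w, l x ≤ m := by
        rintro x (h | h)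
        · exact le_of_lt h
        · exact (hseg x h).le
      intro x hx y hy a b ha hb hab
      have hm : a * m + b * m = m := by rw [← add_mul, hab, one_mul]
      have hlx := mul_le_mul_of_nonneg_left (hle' x hx) ha.le
      have hly := mul_le_mul_of_nonneg_left (hle' y hy) hb.le
      rcases hx with hx | hx
      · left
        have := mul_lt_mul_of_pos_left (show l x < m from hx) ha
        simp only [Set.mem_ofPred_eq, map_add, map_smul, smul_eq_mul]
        linarith
      rcases hy with hy | hy
      · left
        have := mul_lt_mul_of_pos_left (show l y < m from hy) hb
        simp only [Set.mem_ofPred_eq, map_add, map_smul, smul_eq_mul]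
        linarith
      · exact Or.inr (convex_segment v w hx hy ha.le hb.le hab)
  have hmax : ∀ y ∈ convexHull ℝ S, l y ≤ m := by
    intro y hy
    rcases hcover hy with h | h
    · exact le_of_lt h
    · exact (hseg y h).le
  ext x
  constructor
  · intro hx
    refine ⟨segment_subset_convexHull hv hw hx, fun y hy ↦ ?_⟩
    rw [hseg x hx]
    exact hmax y hy
  · rintro ⟨hx, hxmax⟩
    rcases hcover hx with h | h
    · have := hxmax v (subset_convexHull ℝ S hv)
      rw [hvm] at this
      exact absurd (show l x < m from h) (not_lt.2 this)
    · exact h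

lemma left_mem_extremePoints_segment {E : Type*} [AddCommGroup E] [Module ℝ E] (v w : E) :
    v ∈ (segment ℝ v w).extremePoints ℝ := by
  refine ⟨left_mem_segment ℝ v w, ?_⟩
  intro x hx y hy hv
  rw [segment_eq_image'] at hx hy
  obtain ⟨s, ⟨hs, -⟩, rfl⟩ := hx
  obtain ⟨t, ⟨ht, -⟩, rfl⟩ := hy
  obtain ⟨a, b, ha, hb, hab, h⟩ := hv
  have h' : (a * s + b * t) • (w - v) = 0 := by
    have : a • (v + s • (w - v)) + b • (v + t • (w - v))
        = (a + b) • v + (a * s + b * t) • (w - v) := by module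
    rw [this, hab, one_smul] at h
    simpa using h
  rcases smul_eq_zero.1 h' with h0 | h0
  · have : s = 0 := by
      have := mul_nonneg ha.le hs
      have := mul_nonneg hb.le ht
      have : a * s = 0 := by linarith
      exact (mul_eq_zero.1 this).resolve_left ha.ne'
    simp [this]
  · simp [h0]

lemma IsEdge.left_mem_extremePoints {d : Type*} {P : Set (d → ℝ)} {v w : d → ℝ}
    (h : IsEdge P v w) : v ∈ P.extremePoints ℝ :=
  h.2.isExtreme.extremePoints_subset_extremePoints (left_mem_extremePoints_segment v w)

lemma IsEdge.symm {d : Type*} {P : Set (d → ℝ)} {v w : d → ℝ} (h : IsEdge P v w) :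
    IsEdge P w v :=
  ⟨h.1.symm, by rw [segment_symm]; exact h.2⟩

lemma isPrimitiveVector_of_isUnit_apply {d : Type*} {z : d → ℤ} {i : d} (h : IsUnit (z i)) :
    IsPrimitiveVector z :=
  fun _ hk ↦ isUnit_of_dvd_unit (hk i) h

lemma IsPrimitiveVector.eq_of_latticeVector_eq_smul {d : Type*} {z z' : d → ℤ} {t : ℝ}
    (hz : IsPrimitiveVector z) (ht : 0 < t) {i : d} (hi : IsUnit (z' i))
    (h : latticeVector z' = t • latticeVector z) : z = z' := by
  have hc : ∀ j, (z' j : ℝ) = t * z j := fun j ↦ congrFun h j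
  have hsq : (z' i : ℝ) * z' i = 1 := by
    exact_mod_cast Int.isUnit_mul_self hi
  have htn : t * ((z i * z' i : ℤ) : ℝ) = 1 := by
    push_cast
    rw [← mul_assoc, ← hc i, hsq]
  -- Since `z' i = ±1`, the factor `1 / t` is the integer `z i * z' i`; it divides every coordinate
  -- of the primitive `z` and is positive, hence is 1.
  have hmul : ∀ j, z j = (z i * z' i) * z' j := by
    intro j
    have : (z j : ℝ) = ((z i * z' i : ℤ) : ℝ) * z' j := by
      rw [hc j, ← mul_assoc, mul_comm _ t, htn, one_mul]
    exact_mod_cast this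
  have hpos : 0 < z i * z' i := by
    have : 0 < ((z i * z' i : ℤ) : ℝ) := by
      by_contra! hneg
      nlinarith [mul_nonneg ht.le (neg_nonneg.2 hneg)]
    exact_mod_cast this
  have hone : z i * z' i = 1 := by
    rcases Int.isUnit_iff.1 (hz _ fun j ↦ ⟨_, hmul j⟩) with h1 | h1
    · exact h1
    · omega
  ext j
  rw [hmul j, hone, one_mul]

/-! ### Indicator vectors and edges under block exchange -/

namespace Matroid

/-- The indicator vector of `I` in `R^E`, with `E` the ground set of `M`. -/
noncomputable def indicatorVector {α : Type*} (R : Type*) [Zero R] [One R] (M : Matroid α) (I : Set α) :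
    M.E → R :=
  Set.indicator {e : M.E | (e : α) ∈ I} 1

variable {α : Type*} {M : Matroid α} {I J : Set α}

lemma indicatorVector_of_mem (R : Type*) [Zero R] [One R] {e : M.E} (h : (e : α) ∈ I) :
    M.indicatorVector R I e = 1 :=
  Set.indicator_of_mem (s := {e : M.E | (e : α) ∈ I}) h _

lemma indicatorVector_of_notMem (R : Type*) [Zero R] [One R] {e : M.E} (h : (e : α) ∉ I) :
    M.indicatorVector R I e = 0 :=
  Set.indicator_of_notMem (s := {e : M.E | (e : α) ∈ I}) h _

lemma indicatorVector_apply_eq_iff {R : Type*} [Zero R] [One R] [NeZero (1 : R)] {e : M.E} :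
    M.indicatorVector R I e = M.indicatorVector R J e ↔ ((e : α) ∈ I ↔ (e : α) ∈ J) := by
  by_cases hI : (e : α) ∈ I <;> by_cases hJ : (e : α) ∈ J <;>
    simp [indicatorVector_of_mem, indicatorVector_of_notMem, hI, hJ]

lemma indicatorVector_injective_of_subset {R : Type*} [Zero R] [One R] [NeZero (1 : R)]
    (hI : I ⊆ M.E) (hJ : J ⊆ M.E) (h : M.indicatorVector R I = M.indicatorVector R J) :
    I = J := by
  ext e
  by_cases he : e ∈ M.E
  · exact indicatorVector_apply_eq_iff.1 (congrFun h ⟨e, he⟩)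
  · exact iff_of_false (fun h ↦ he (hI h)) (fun h ↦ he (hJ h))

lemma latticeVector_indicatorVector (M : Matroid α) (I : Set α) :
    latticeVector (M.indicatorVector ℤ I) = M.indicatorVector ℝ I := by
  ext e
  by_cases hI : (e : α) ∈ I <;>
    simp [latticeVector, indicatorVector_of_mem, indicatorVector_of_notMem, hI]

lemma independencePolytope_eq (M : Matroid α) :
    M.independencePolytope = convexHull ℝ {x | ∃ I, M.Indep I ∧ x = M.indicatorVector ℝ I} :=
  rfl

lemma Indep.indicatorVector_mem_independencePolytope (h : M.Indep I) :
    M.indicatorVector ℝ I ∈ M.independencePolytope :=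
  subset_convexHull ℝ _ ⟨I, h, rfl⟩

lemma exists_indep_of_mem_extremePoints {v : M.E → ℝ}
    (hv : v ∈ M.independencePolytope.extremePoints ℝ) :
    ∃ I, M.Indep I ∧ v = M.indicatorVector ℝ I :=
  extremePoints_convexHull_subset (A := {x | ∃ I, M.Indep I ∧ x = M.indicatorVector ℝ I}) hv

lemma isLatticePolytope_independencePolytope (M : Matroid α) [M.Finite] :
    IsLatticePolytope M.independencePolytope := by
  have hfin : {I | M.Indep I}.Finite :=
    M.ground_finite.finite_subsets.subset fun I hI ↦ Indep.subset_ground hI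
  refine ⟨(hfin.image (M.indicatorVector ℤ)).toFinset, ?_⟩
  rw [independencePolytope_eq, Set.Finite.coe_toFinset, Set.image_image]
  congr 1
  ext x
  simp [latticeVector_indicatorVector, eq_comm]

/-- If two independent sets differ on a class of `p` and exchanging that class preserves
independence, then they can only be joined by an edge if they agree off that class. -/
lemma eq_exchange_of_isEdge {ι : Type*} {p : α → ι} {i : ι}
    (hI : M.Indep I) (hJ : M.Indep J)
    (hIJ : M.Indep {e | (p e = i ∧ e ∈ J) ∨ (p e ≠ i ∧ e ∈ I)})
    (hJI : M.Indep {e | (p e = i ∧ e ∈ I) ∨ (p e ≠ i ∧ e ∈ J)})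
    (h : IsEdge M.independencePolytope (M.indicatorVector ℝ I) (M.indicatorVector ℝ J))
    {e : α} (hei : p e = i) (he : ¬ (e ∈ I ↔ e ∈ J)) :
    {e | (p e = i ∧ e ∈ J) ∨ (p e ≠ i ∧ e ∈ I)} = J := by
  set A := {e | (p e = i ∧ e ∈ J) ∨ (p e ≠ i ∧ e ∈ I)} with hA
  set B := {e | (p e = i ∧ e ∈ I) ∨ (p e ≠ i ∧ e ∈ J)} with hB
  have hsum : M.indicatorVector ℝ A + M.indicatorVector ℝ B
      = M.indicatorVector ℝ I + M.indicatorVector ℝ J := by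
    ext g
    by_cases hg : p g = i
    · have h1 : M.indicatorVector ℝ A g = M.indicatorVector ℝ J g :=
        indicatorVector_apply_eq_iff.2 (by simp [hA, hg])
      have h2 : M.indicatorVector ℝ B g = M.indicatorVector ℝ I g :=
        indicatorVector_apply_eq_iff.2 (by simp [hB, hg])
      simp [h1, h2, add_comm]
    · have h1 : M.indicatorVector ℝ A g = M.indicatorVector ℝ I g :=
        indicatorVector_apply_eq_iff.2 (by simp [hA, hg])
      have h2 : M.indicatorVector ℝ B g = M.indicatorVector ℝ J g :=
        indicatorVector_apply_eq_iff.2 (by simp [hB, hg])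
      simp [h1, h2]
  -- The pairs `A`, `B` and `I`, `J` have the same midpoint; as the edge is a face, it must contain
  -- `A`.
  have hmem : M.indicatorVector ℝ A ∈
      segment ℝ (M.indicatorVector ℝ I) (M.indicatorVector ℝ J) := by
    refine h.2.isExtreme.left_mem_of_mem_openSegment
      hIJ.indicatorVector_mem_independencePolytope hJI.indicatorVector_mem_independencePolytope
      (z := (1 / 2 : ℝ) • M.indicatorVector ℝ I + (1 / 2 : ℝ) • M.indicatorVector ℝ J)
      ⟨1 / 2, 1 / 2, by norm_num, by norm_num, by norm_num, rfl⟩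
      ⟨1 / 2, 1 / 2, by norm_num, by norm_num, by norm_num, ?_⟩
    rw [← smul_add, ← smul_add, hsum]
  rw [segment_eq_image'] at hmem
  obtain ⟨t, -, ht⟩ := hmem
  have heE : e ∈ M.E := by
    by_contra hE
    exact he (iff_of_false (fun h ↦ hE (hI.subset_ground h)) fun h ↦ hE (hJ.subset_ground h))
  have h1 : M.indicatorVector ℝ A ⟨e, heE⟩ = M.indicatorVector ℝ J ⟨e, heE⟩ :=
    indicatorVector_apply_eq_iff.2 (by simp [hA, hei])
  have hne : M.indicatorVector ℝ I ⟨e, heE⟩ ≠ M.indicatorVector ℝ J ⟨e, heE⟩ :=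
    fun h ↦ he (indicatorVector_apply_eq_iff.1 h)
  have ht1 : t = 1 := by
    have h2 := congrFun ht ⟨e, heE⟩
    simp only [Pi.add_apply, Pi.smul_apply, Pi.sub_apply, smul_eq_mul, h1] at h2
    have h3 : (t - 1) * (M.indicatorVector ℝ J ⟨e, heE⟩ - M.indicatorVector ℝ I ⟨e, heE⟩) = 0 := by
      linarith
    rcases mul_eq_zero.1 h3 with h4 | h4
    · linarith
    · exact absurd (by linarith) hne
  refine indicatorVector_injective_of_subset (R := ℝ) hIJ.subset_ground hJ.subset_ground ?_
  rw [← ht, ht1]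
  simp

/-! ### Smoothness from block exchange -/

open Classical in
/-- The involution of `ℤ^E` attached to a subset `I` meeting each fibre of `p` in at most one
element: the coordinate at `f ∈ I` is replaced by minus the sum over the fibre of `f`. -/
noncomputable def fiberReflection {d ι : Type*} [Fintype d] (p : d → ι) (I : Set d)
    (hI : ∀ e ∈ I, ∀ f ∈ I, p e = p f → e = f) : (d → ℤ) ≃ₗ[ℤ] (d → ℤ) :=
  LinearEquiv.ofInvolutive
    { toFun := fun x f ↦ if f ∈ I then -∑ h with p h = p f, x h else x f
      map_add' := by
        intro x y
        ext f
        by_cases hf : f ∈ I <;> simp [hf, Finset.sum_add_distrib, add_comm]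
      map_smul' := by
        intro c x
        ext f
        by_cases hf : f ∈ I <;> simp [hf, Finset.mul_sum] }
    (by
      intro x
      ext f
      by_cases hf : f ∈ I
      · have hmem : f ∈ Finset.univ.filter fun h ↦ p h = p f := by simp
        have hrest : ∀ h ∈ (Finset.univ.filter fun h ↦ p h = p f).erase f,
            (if h ∈ I then -∑ k with p k = p h, x k else x h) = x h := by
          intro h hh
          rw [Finset.mem_erase, Finset.mem_filter] at hh
          exact if_neg fun hI' ↦ hh.1 (hI h hI' f hf hh.2.2)
        simp only [LinearMap.coe_mk, AddHom.coe_mk, if_pos hf]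
        rw [← Finset.add_sum_erase _ _ hmem, Finset.sum_congr rfl hrest, if_pos hf,
          ← Finset.add_sum_erase _ _ hmem]
        ring
      · simp [hf])

open Classical in
lemma fiberReflection_apply {d ι : Type*} [Fintype d] (p : d → ι) (I : Set d)
    (hI : ∀ e ∈ I, ∀ f ∈ I, p e = p f → e = f) (x : d → ℤ) (f : d) :
    fiberReflection p I hI x f = if f ∈ I then -∑ h with p h = p f, x h else x f :=
  rfl

open Classical in
lemma fiberReflection_single_apply {d ι : Type*} [Fintype d] [DecidableEq d] (p : d → ι) (I : Set d)
    (hI : ∀ e ∈ I, ∀ f ∈ I, p e = p f → e = f) (e f : d) :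
    fiberReflection p I hI (Pi.single e 1) f =
      if f ∈ I then (if p e = p f then -1 else 0) else (if f = e then 1 else 0) := by
  rw [fiberReflection_apply]
  split_ifs with h1 h2 h2
  · rw [Finset.sum_filter]
    rw [Finset.sum_eq_single e] <;> simp +contextual [h2]
  · rw [Finset.sum_eq_zero]
    · simp
    · intro h hh
      rw [Finset.mem_filter] at hh
      exact Pi.single_eq_of_ne (fun h3 ↦ h2 (by rw [← h3]; exact hh.2)) _
  · simp [h2]
  · simp [h2]

/-- At the vertex `I` the basis is the image of the standard one under `fiberReflection`: `-e_f` for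
`f ∈ I`, `e_f - e_g` if `f ∉ I` shares its fibre with `g ∈ I`, and `e_f` otherwise. -/
theorem isSmoothPolytope_of_exchange [M.Finite] {ι : Type*} (p : α → ι)
    (hsub : ∀ I, M.Indep I → ∀ e ∈ I, ∀ f ∈ I, p e = p f → e = f)
    (hex : ∀ I J i, M.Indep I → M.Indep J →
      M.Indep {e | (p e = i ∧ e ∈ J) ∨ (p e ≠ i ∧ e ∈ I)}) :
    IsSmoothPolytope M.independencePolytope := by
  classical
  have : Fintype M.E := M.ground_finite.fintype
  refine ⟨M.isLatticePolytope_independencePolytope, fun v hv ↦ ?_⟩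
  obtain ⟨I, hI, rfl⟩ := exists_indep_of_mem_extremePoints hv
  have hI' : ∀ e ∈ {e : M.E | (e : α) ∈ I}, ∀ f ∈ {e : M.E | (e : α) ∈ I},
      p (e : α) = p f → e = f := fun e he f hf h ↦ Subtype.ext (hsub I hI e he f hf h)
  let T := fiberReflection (fun e : M.E ↦ p e) {e : M.E | (e : α) ∈ I} hI'
  refine ⟨(Pi.basisFun ℤ M.E).map T, ?_⟩
  rintro z ⟨hz, w, hw, t, ht, hwz⟩
  obtain ⟨J, hJ, rfl⟩ := exists_indep_of_mem_extremePoints hw.symm.left_mem_extremePoints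
  obtain ⟨e, he⟩ : ∃ e, ¬ (e ∈ I ↔ e ∈ J) := by
    by_contra! hcon
    exact hw.1 (congrArg _ (Set.ext hcon))
  have hJeq := eq_exchange_of_isEdge hI hJ (hex I J (p e) hI hJ) (hex J I (p e) hJ hI) hw rfl he
  have hoff : ∀ g, p g ≠ p e → (g ∈ I ↔ g ∈ J) := by
    intro g hg
    rw [← hJeq]
    simp [hg]
  -- The index of the basis vector is the element of `J` in the changed fibre, or, if there is none,
  -- the element that leaves `I`.
  obtain ⟨f, hfe, hfIJ, hfJ⟩ : ∃ f, p f = p e ∧ (f ∈ I ∨ f ∈ J) ∧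
      ((∃ g ∈ J, p g = p e) → f ∈ J) := by
    by_cases h : ∃ g ∈ J, p g = p e
    · obtain ⟨g, hg, hge⟩ := h
      exact ⟨g, hge, Or.inr hg, fun _ ↦ hg⟩
    · refine ⟨e, rfl, ?_, fun h' ↦ absurd h' h⟩
      tauto
  have hfE : f ∈ M.E := hfIJ.elim (fun h ↦ hI.subset_ground h) fun h ↦ hJ.subset_ground h
  refine ⟨⟨f, hfE⟩, ?_⟩
  have hb : (Pi.basisFun ℤ M.E).map T ⟨f, hfE⟩ = T (Pi.single ⟨f, hfE⟩ 1) := by simp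
  have hT : ∀ g, T (Pi.single ⟨f, hfE⟩ 1) g =
      if (g : α) ∈ I then (if p f = p g then -1 else 0) else (if g = ⟨f, hfE⟩ then 1 else 0) :=
    fun g ↦ by simp [T, fiberReflection_single_apply]
  rw [hb]
  symm
  refine hz.eq_of_latticeVector_eq_smul ht (i := ⟨f, hfE⟩) ?_ ?_
  · rw [hT]
    by_cases hfI : f ∈ I <;> simp [hfI]
  · rw [← hwz]
    ext g
    rw [latticeVector, hT, Pi.sub_apply]
    by_cases hge : p g = p e
    · by_cases hgI : (g : α) ∈ I
      · have hgJ : (g : α) ∉ J := by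
          intro hgJ
          refine he (?_ : e ∈ I ↔ e ∈ J)
          constructor
          · intro h
            rwa [← hsub I hI g hgI e h hge]
          · intro h
            rwa [← hsub J hJ g hgJ e h hge]
        rw [indicatorVector_of_mem _ hgI, indicatorVector_of_notMem _ hgJ]
        simp [hgI, hfe, hge]
      · rw [indicatorVector_of_notMem _ hgI]
        by_cases hgf : g = ⟨f, hfE⟩
        · subst hgf
          rw [indicatorVector_of_mem _ (hfIJ.resolve_left hgI)]
          simp [hgI]
        · have hgJ : (g : α) ∉ J := fun h ↦
            hgf (Subtype.ext (hsub J hJ g h f (hfJ ⟨g, h, hge⟩) (hge.trans hfe.symm)))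
          rw [indicatorVector_of_notMem _ hgJ]
          simp [hgI, hgf]
    · have hgf : g ≠ ⟨f, hfE⟩ := by
        rintro rfl
        exact hge hfe
      rw [indicatorVector_apply_eq_iff.2 (hoff g hge), sub_self]
      have hpf : p f ≠ p g := fun h ↦ hge (h.symm.trans hfe)
      simp [hgf, hpf]

end Matroid

/-! ### Smoothness bounds the size of circuits -/

namespace Matroid

variable {α : Type*} {M : Matroid α} {I C : Set α} {a b : α}

lemma isEdge_of_isMaximum [Fintype M.E] {J : Set α} (hI : M.Indep I) (hJ : M.Indep J)
    (hne : I ≠ J) (c : M.E → ℝ) (m : ℝ)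
    (hle : ∀ K, M.Indep K → ∑ g, c g * M.indicatorVector ℝ K g ≤ m)
    (heq : ∀ K, M.Indep K → (∑ g, c g * M.indicatorVector ℝ K g = m ↔ K = I ∨ K = J)) :
    IsEdge M.independencePolytope (M.indicatorVector ℝ I) (M.indicatorVector ℝ J) := by
  have hinj : ∀ {K L}, M.Indep K → M.Indep L →
      (M.indicatorVector ℝ K = M.indicatorVector ℝ L ↔ K = L) := fun hK hL ↦
    ⟨indicatorVector_injective_of_subset hK.subset_ground hL.subset_ground, congrArg _⟩
  refine ⟨fun h ↦ hne ((hinj hI hJ).1 h), ?_⟩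
  have hl : ∀ x : M.E → ℝ,
      (∑ g, c g • ContinuousLinearMap.proj (R := ℝ) (φ := fun _ : M.E ↦ ℝ) g) x
        = ∑ g, c g * x g := by
    intro x
    simp
  refine isExposed_convexHull_segment ⟨I, hI, rfl⟩ ⟨J, hJ, rfl⟩
    (∑ g, c g • ContinuousLinearMap.proj (R := ℝ) (φ := fun _ : M.E ↦ ℝ) g) m ?_ ?_
  · rintro _ ⟨K, hK, rfl⟩
    exact (hl _).trans_le (hle K hK)
  · rintro _ ⟨K, hK, rfl⟩
    rw [hl]
    exact (heq K hK).trans (or_congr (hinj hK hI).symm (hinj hK hJ).symm)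

/-- Removing one element from an independent set gives an edge. -/
lemma Indep.isEdge_diff_singleton [Fintype M.E] (hI : M.Indep I) (ha : a ∈ I) :
    IsEdge M.independencePolytope (M.indicatorVector ℝ I)
      (M.indicatorVector ℝ (I \ {a})) := by
  classical
  -- Any deviation from `I` costs 1, except at `a`, where it is free.
  let c : M.E → ℝ := fun g ↦ if (g : α) = a then 0 else if (g : α) ∈ I then 1 else -1
  have hterm : ∀ K : Set α, ∀ g ∈ Finset.univ, 0 ≤ c g * M.indicatorVector ℝ I g -
      c g * M.indicatorVector ℝ K g := by
    intro K g _
    by_cases hga : (g : α) = a <;> by_cases hgI : (g : α) ∈ I <;> by_cases hgK : (g : α) ∈ K <;>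
      simp [c, hga, hgI, hgK, indicatorVector_of_mem, indicatorVector_of_notMem]
  refine isEdge_of_isMaximum hI (hI.subset Set.sdiff_subset) ?_ c
    (∑ g, c g * M.indicatorVector ℝ I g) ?_ ?_
  · intro h
    rw [h] at ha
    exact ha.2 rfl
  · intro K _
    have := Finset.sum_nonneg (hterm K)
    rw [Finset.sum_sub_distrib] at this
    linarith
  · intro K hK
    have hzero := Finset.sum_eq_zero_iff_of_nonneg (hterm K)
    rw [Finset.sum_sub_distrib, sub_eq_zero, eq_comm] at hzero
    rw [hzero]
    constructor
    · intro h
      have hag : ∀ g, g ≠ a → (g ∈ K ↔ g ∈ I) := by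
        intro g hga
        by_cases hgE : g ∈ M.E
        · have := h ⟨g, hgE⟩ (Finset.mem_univ _)
          rw [← mul_sub, mul_eq_zero, sub_eq_zero, eq_comm (a := M.indicatorVector ℝ I _)] at this
          refine indicatorVector_apply_eq_iff.1 (this.resolve_left ?_)
          by_cases hgI : g ∈ I <;> simp [c, hga, hgI]
        · exact iff_of_false (fun h ↦ hgE (hK.subset_ground h)) fun h ↦ hgE (hI.subset_ground h)
      by_cases haK : a ∈ K
      · left
        ext g
        by_cases hga : g = a
        · subst hga
          exact iff_of_true haK ha
        · exact hag g hga
      · right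
        ext g
        by_cases hga : g = a
        · subst hga
          simp [haK]
        · simp [hag g hga, hga]
    · rintro (rfl | rfl) g -
      · simp
      · by_cases hga : (g : α) = a
        · simp [c, hga]
        · have hag : M.indicatorVector ℝ (I \ {a}) g = M.indicatorVector ℝ I g :=
            indicatorVector_apply_eq_iff.2 (by simp [hga])
          rw [hag, sub_self]

/-- The sets obtained by removing one of two elements of a circuit are joined by an edge. -/
lemma IsCircuit.isEdge_diff_singleton [Fintype M.E] (hC : M.IsCircuit C) (ha : a ∈ C)
    (hb : b ∈ C) (hab : a ≠ b) :
    IsEdge M.independencePolytope (M.indicatorVector ℝ (C \ {a}))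
      (M.indicatorVector ℝ (C \ {b})) := by
  classical
  -- An independent set must omit some element of `C`, at cost at least 1; the cost is exactly 1
  -- only if `a` or `b` alone is omitted and nothing outside `C` is added.
  let c : M.E → ℝ := fun g ↦
    if (g : α) ∈ C then (if (g : α) = a ∨ (g : α) = b then 1 else 2) else -1
  have hterm : ∀ K : Set α, ∀ g, 0 ≤ c g * M.indicatorVector ℝ C g -
      c g * M.indicatorVector ℝ K g := by
    intro K g
    by_cases hgab : (g : α) = a ∨ (g : α) = b <;> by_cases hgC : (g : α) ∈ C <;>
      by_cases hgK : (g : α) ∈ K <;>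
      simp [c, hgab, hgC, hgK, indicatorVector_of_mem, indicatorVector_of_notMem]
  have hsplit : ∀ K : Set α, ∀ g : M.E, (g : α) ∈ C → (g : α) ∉ K →
      ∑ g, c g * M.indicatorVector ℝ K g = ∑ g, c g * M.indicatorVector ℝ C g -
        (c g + ∑ h ∈ Finset.univ.erase g,
          (c h * M.indicatorVector ℝ C h - c h * M.indicatorVector ℝ K h)) := by
    intro K g hgC hgK
    have hg : c g = c g * M.indicatorVector ℝ C g - c g * M.indicatorVector ℝ K g := by
      rw [indicatorVector_of_mem _ hgC, indicatorVector_of_notMem _ hgK]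
      ring
    have hsum := Finset.add_sum_erase _ (fun h ↦ c h * M.indicatorVector ℝ C h -
      c h * M.indicatorVector ℝ K h) (Finset.mem_univ g)
    rw [Finset.sum_sub_distrib (s := Finset.univ)] at hsum
    linarith
  have hmiss : ∀ K, M.Indep K → ∃ g : M.E, (g : α) ∈ C ∧ (g : α) ∉ K := by
    intro K hK
    obtain ⟨g, hgC, hgK⟩ := Set.not_subset.1 fun h ↦ hC.not_indep (hK.subset h)
    exact ⟨⟨g, hC.subset_ground hgC⟩, hgC, hgK⟩
  have hc : ∀ g : M.E, (g : α) ∈ C → 1 ≤ c g := by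
    intro g hg
    by_cases hgab : (g : α) = a ∨ (g : α) = b <;> simp [c, hg, hgab]
  have hval : ∀ x (hx : x ∈ C), x = a ∨ x = b →
      ∑ g, c g * M.indicatorVector ℝ (C \ {x}) g = ∑ g, c g * M.indicatorVector ℝ C g - 1 := by
    intro x hx hxab
    have hc1 : c ⟨x, hC.subset_ground hx⟩ = 1 := by simp [c, hx, hxab]
    rw [hsplit (C \ {x}) ⟨x, hC.subset_ground hx⟩ hx (by simp), hc1, add_eq_left.2]
    refine Finset.sum_eq_zero fun h hh ↦ ?_
    have hhx : (h : α) ≠ x := fun h1 ↦ (Finset.mem_erase.1 hh).1 (Subtype.ext h1)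
    have hCx : M.indicatorVector ℝ (C \ {x}) h = M.indicatorVector ℝ C h :=
      indicatorVector_apply_eq_iff.2 (by simp [hhx])
    rw [hCx, sub_self]
  refine isEdge_of_isMaximum (hC.sdiff_singleton_indep ha) (hC.sdiff_singleton_indep hb) ?_ c
    (∑ g, c g * M.indicatorVector ℝ C g - 1) ?_ ?_
  · intro h
    have : b ∈ C \ {b} := h ▸ ⟨hb, fun h ↦ hab h.symm⟩
    exact this.2 rfl
  · intro K hK
    obtain ⟨g, hgC, hgK⟩ := hmiss K hK
    rw [hsplit K g hgC hgK]
    have := Finset.sum_nonneg fun h (_ : h ∈ Finset.univ.erase g) ↦ hterm K h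
    linarith [hc g hgC]
  · intro K hK
    constructor
    · intro h
      obtain ⟨g, hgC, hgK⟩ := hmiss K hK
      rw [hsplit K g hgC hgK] at h
      have hnonneg : ∀ h ∈ Finset.univ.erase g, 0 ≤ c h * M.indicatorVector ℝ C h -
        c h * M.indicatorVector ℝ K h := fun h _ ↦ hterm K h
      have hs := Finset.sum_nonneg hnonneg
      have hcg := hc g hgC
      have hsum : ∑ h ∈ Finset.univ.erase g, (c h * M.indicatorVector ℝ C h -
        c h * M.indicatorVector ℝ K h) = 0 := by linarith
      have hg1 : c g = 1 := by linarith
      have hgab : (g : α) = a ∨ (g : α) = b := by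
        by_contra hgab
        simp [c, hgC, hgab] at hg1
      have hK' : K = C \ {(g : α)} := by
        ext x
        by_cases hxg : x = g
        · subst hxg
          simp [hgK]
        by_cases hxE : x ∈ M.E
        · have := (Finset.sum_eq_zero_iff_of_nonneg hnonneg).1 hsum ⟨x, hxE⟩
            (Finset.mem_erase.2 ⟨fun h ↦ hxg (congrArg Subtype.val h), Finset.mem_univ _⟩)
          rw [← mul_sub, mul_eq_zero, sub_eq_zero, eq_comm (a := M.indicatorVector ℝ C _)] at this
          have h1 := indicatorVector_apply_eq_iff.1 (this.resolve_left ?_)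
          · simpa [hxg] using h1
          · by_cases hxC : x ∈ C <;> by_cases hxab : x = a ∨ x = b <;> simp [c, hxC, hxab]
        · exact iff_of_false (fun h ↦ hxE (hK.subset_ground h))
            fun h ↦ hxE (hC.subset_ground h.1)
      rcases hgab with h1 | h1
      · exact Or.inl (h1 ▸ hK')
      · exact Or.inr (h1 ▸ hK')
    · rintro (rfl | rfl)
      · exact hval a ha (Or.inl rfl)
      · exact hval b hb (Or.inr rfl)

theorem IsCircuit.encard_le_two_of_isSmoothPolytope [M.Finite]
    (hM : IsSmoothPolytope M.independencePolytope) (hC : M.IsCircuit C) : C.encard ≤ 2 := by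
  classical
  have : Fintype M.E := M.ground_finite.fintype
  by_contra! hcard
  have hCfin : C.Finite := M.ground_finite.subset hC.subset_ground
  rw [← hCfin.cast_ncard_eq] at hcard
  obtain ⟨x, y, z, hx, hy, hz, hxy, hxz, hyz⟩ :=
    (Set.two_lt_ncard_iff hCfin).1 (by exact_mod_cast hcard)
  set I := C \ {x} with hI_def
  have hI : M.Indep I := hC.sdiff_singleton_indep hx
  have hyI : y ∈ I := ⟨hy, hxy.symm⟩
  have hzI : z ∈ I := ⟨hz, hxz.symm⟩
  obtain ⟨B, hB⟩ := hM.2 _ (hI.isEdge_diff_singleton hyI).left_mem_extremePoints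
  let s : α → M.E → ℤ := fun e f ↦ if (f : α) = e then 1 else 0
  have hremove : ∀ e ∈ I, -s e ∈ Set.range B := by
    intro e he
    refine hB ⟨?_, _, hI.isEdge_diff_singleton he, 1, one_pos, ?_⟩
    · refine isPrimitiveVector_of_isUnit_apply (i := ⟨e, hI.subset_ground he⟩) ?_
      simp [s]
    · ext f
      by_cases hf : (f : α) = e
      · have h1 : (f : α) ∈ I := hf ▸ he
        simp [latticeVector, s, hf, indicatorVector_of_mem, indicatorVector_of_notMem, he]
      · simp only [Pi.sub_apply]
        have hIe : M.indicatorVector ℝ (I \ {e}) f = M.indicatorVector ℝ I f :=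
          indicatorVector_apply_eq_iff.2 (by simp [hf])
        rw [hIe]
        simp [latticeVector, s, hf]
  have hswap : ∀ e ∈ I, s x - s e ∈ Set.range B := by
    intro e he
    have hex : e ≠ x := he.2
    refine hB ⟨?_, _, hC.isEdge_diff_singleton hx he.1 hex.symm, 1, one_pos, ?_⟩
    · refine isPrimitiveVector_of_isUnit_apply (i := ⟨x, hC.subset_ground hx⟩) ?_
      simp [s, hex.symm]
    · ext f
      simp only [Pi.sub_apply, hI_def]
      by_cases hf : (f : α) = e
      · simp [latticeVector, s, hf, indicatorVector_of_mem, indicatorVector_of_notMem, he.1, hex]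
      by_cases hf' : (f : α) = x
      · simp [latticeVector, s, hf', indicatorVector_of_mem, indicatorVector_of_notMem, hx,
          hex.symm]
      · have hCe : M.indicatorVector ℝ (C \ {e}) f = M.indicatorVector ℝ (C \ {x}) f :=
          indicatorVector_apply_eq_iff.2 (by simp [hf, hf'])
        rw [hCe]
        simp [latticeVector, s, hf, hf']
  obtain ⟨i, hi⟩ := hremove y hyI
  obtain ⟨j, hj⟩ := hremove z hzI
  obtain ⟨k, hk⟩ := hswap y hyI
  obtain ⟨l, hl⟩ := hswap z hzI
  have hrel : B i + B l = B k + B j := by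
    rw [hi, hj, hk, hl]
    abel
  have hij : j ≠ i := by
    rintro rfl
    have := congrFun (hi.symm.trans hj) ⟨y, hC.subset_ground hy⟩
    simp [s, hyz] at this
  have hik : k ≠ i := by
    rintro rfl
    have := congrFun (hi.symm.trans hk) ⟨x, hC.subset_ground hx⟩
    simp [s, hxy] at this
  have hil : l ≠ i := by
    rintro rfl
    have := congrFun (hi.symm.trans hl) ⟨x, hC.subset_ground hx⟩
    simp [s, hxy, hxz] at this
  -- Since `i` differs from `j`, `k` and `l`, the `i`-th coordinate of the relation reads `1 = 0`.
  have := congrArg (fun v ↦ B.repr v i) hrel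
  simp [hij, hik, hil] at this

/-! ### Decomposition into parallel classes -/

/-- The class of `e`: the singleton of `e` and, if `e` is a nonloop, all elements parallel to it. -/
def parallelClass (M : Matroid α) (e : α) : Set α :=
  {f | f = e ∨ (M.IsNonloop e ∧ M.IsNonloop f ∧ M.closure {e} = M.closure {f})}

lemma mem_parallelClass_self (M : Matroid α) (e : α) : e ∈ M.parallelClass e :=
  Or.inl rfl

lemma parallelClass_eq_of_mem {e f : α} (h : f ∈ M.parallelClass e) :
    M.parallelClass f = M.parallelClass e := by
  rcases h with rfl | ⟨he, hf, hef⟩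
  · rfl
  · ext g
    constructor
    · rintro (rfl | ⟨-, hg, hfg⟩)
      · exact Or.inr ⟨he, hf, hef⟩
      · exact Or.inr ⟨he, hg, hef.trans hfg⟩
    · rintro (rfl | ⟨-, hg, hfg⟩)
      · exact Or.inr ⟨hf, he, hef.symm⟩
      · exact Or.inr ⟨hf, hg, hef.symm.trans hfg⟩

lemma parallelClass_subset_ground {e : α} (he : e ∈ M.E) : M.parallelClass e ⊆ M.E := by
  rintro f (rfl | ⟨-, hf, -⟩)
  · exact he
  · exact hf.mem_ground

lemma isSingleLoop_or_isUniformOfRank_one_restrict_parallelClass {e : α} (he : e ∈ M.E) :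
    (M ↾ M.parallelClass e).IsSingleLoop ∨ (M ↾ M.parallelClass e).IsUniformOfRank 1 := by
  by_cases hl : M.IsNonloop e
  · right
    have hnl : ∀ f ∈ M.parallelClass e, M.IsNonloop f := by
      rintro f (rfl | ⟨-, hf, -⟩)
      · exact hl
      · exact hf
    have hcl : ∀ f ∈ M.parallelClass e, M.closure {e} = M.closure {f} := by
      rintro f (rfl | ⟨-, -, hf⟩)
      · rfl
      · exact hf
    refine ⟨?_, fun I ↦ ?_⟩
    · rw [restrict_ground_eq, Nat.cast_one, Set.one_le_encard_iff_nonempty]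
      exact ⟨e, M.mem_parallelClass_self e⟩
    · rw [restrict_indep_iff, restrict_ground_eq, and_comm, Nat.cast_one,
        Set.encard_le_one_iff_subsingleton]
      refine and_congr_right fun hIs ↦ ⟨fun hI f hf g hg ↦ ?_, fun hI ↦ ?_⟩
      · have := (hnl f (hIs hf)).closure_eq_closure_iff_eq_or_dep (hnl g (hIs hg))
        refine (this.1 ((hcl f (hIs hf)).symm.trans (hcl g (hIs hg)))).resolve_right ?_
        exact not_not.2 (hI.subset (Set.pair_subset hf hg))
      · rcases hI.eq_empty_or_singleton with rfl | ⟨f, rfl⟩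
        · exact M.empty_indep
        · exact indep_singleton.2 (hnl f (hIs rfl))
  · left
    have hcls : M.parallelClass e = {e} := by
      ext f
      simp [parallelClass, hl]
    refine ⟨e, eq_loopyOn_iff.2 ⟨hcls, fun X hX hXi ↦ ?_⟩⟩
    rw [restrict_ground_eq, hcls] at hX
    rcases Set.subset_singleton_iff_eq.1 hX with h | rfl
    · exact h
    · exact absurd (indep_singleton.1 hXi.of_restrict) hl

/-- A circuit of size at most two is a loop or a parallel pair, so it lies in a single class; a set
independent in each class therefore contains no circuit. -/
theorem exists_eq_disjointSigma_of_isCircuit_encard_le_two [M.Finite]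
    (hM : ∀ C, M.IsCircuit C → C.encard ≤ 2) :
    ∃ (k : ℕ) (N : Fin k → Matroid α)
      (h : Pairwise (Function.onFun Disjoint fun i => (N i).E)),
      M = Matroid.disjointSigma N h ∧
        ∀ i, (N i).IsSingleLoop ∨ (N i).IsUniformOfRank 1 := by
  have hfin : (M.parallelClass '' M.E).Finite := M.ground_finite.image _
  have := hfin.to_subtype
  obtain ⟨k, ⟨φ⟩⟩ := Finite.exists_equiv_fin (M.parallelClass '' M.E)
  have hφ : ∀ i, ∃ e ∈ M.E, M.parallelClass e = φ.symm i := fun i ↦ (φ.symm i).2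
  have hφ' : ∀ e ∈ M.E, ∃ i, (φ.symm i : Set α) = M.parallelClass e := fun e he ↦
    ⟨φ ⟨_, e, he, rfl⟩, by simp⟩
  have hdisj : Pairwise (Function.onFun Disjoint fun i => (M ↾ (φ.symm i : Set α)).E) := by
    intro i j hij
    refine Set.disjoint_left.2 fun g hgi hgj ↦ hij ?_
    obtain ⟨e, -, he⟩ := hφ i
    obtain ⟨f, -, hf⟩ := hφ j
    replace hgi : g ∈ (φ.symm i : Set α) := hgi
    replace hgj : g ∈ (φ.symm j : Set α) := hgj
    rw [← he] at hgi
    rw [← hf] at hgj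
    refine φ.symm.injective (Subtype.ext ?_)
    rw [← he, ← hf, ← parallelClass_eq_of_mem hgi, parallelClass_eq_of_mem hgj]
  have hground : ⋃ i, (M ↾ (φ.symm i : Set α)).E = M.E := by
    refine subset_antisymm (Set.iUnion_subset fun i ↦ ?_) fun e he ↦ ?_
    · obtain ⟨e, he, hei⟩ := hφ i
      rw [restrict_ground_eq, ← hei]
      exact parallelClass_subset_ground he
    · obtain ⟨i, hi⟩ := hφ' e he
      exact Set.mem_iUnion.2 ⟨i, by rw [restrict_ground_eq, hi]; exact M.mem_parallelClass_self e⟩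
  refine ⟨k, fun i ↦ M ↾ (φ.symm i : Set α), hdisj, ?_, fun i ↦ ?_⟩
  · refine ext_indep (by rw [disjointSigma_ground_eq, hground]) fun I hIE ↦ ?_
    rw [disjointSigma_indep_iff, hground, and_iff_left hIE]
    refine ⟨fun hI i ↦ restrict_indep_iff.2 ⟨hI.inter_right _, Set.inter_subset_right⟩,
      fun hI ↦ ?_⟩
    have hclass : ∀ e ∈ M.E, M.Indep (I ∩ M.parallelClass e) := by
      intro e he
      obtain ⟨i, hi⟩ := hφ' e he
      rw [← hi]
      exact (hI i).of_restrict
    by_contra hdep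
    obtain ⟨C, hCI, hC⟩ := ((not_indep_iff hIE).1 hdep).exists_isCircuit_subset
    obtain ⟨e, he⟩ := hC.nonempty
    refine hC.not_indep ((hclass e (hC.subset_ground he)).subset fun f hf ↦ ⟨hCI hf, ?_⟩)
    by_cases hfe : f = e
    · exact Or.inl hfe
    have hCeq : C = {e, f} := by
      refine ((Set.finite_of_encard_le_coe (hM C hC)).eq_of_subset_of_encard_le'
        (Set.pair_subset he hf) ?_).symm
      rw [Set.encard_pair (Ne.symm hfe)]
      exact hM C hC
    have hne : M.IsNonloop e := by
      rw [← indep_singleton]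
      refine hC.ssubset_indep ?_
      rw [hCeq]
      exact ⟨by simp, fun h ↦ hfe (h (by simp))⟩
    have hnf : M.IsNonloop f := by
      rw [← indep_singleton]
      refine hC.ssubset_indep ?_
      rw [hCeq]
      exact ⟨by simp, fun h ↦ hfe (h (by simp)).symm⟩
    exact Or.inr ⟨hne, hnf, (hne.closure_eq_closure_iff_isCircuit_of_ne (Ne.symm hfe)).2
      (hCeq ▸ hC)⟩
  · obtain ⟨e, he, hei⟩ := hφ i
    simp only [← hei]
    exact isSingleLoop_or_isUniformOfRank_one_restrict_parallelClass he

/-! ### Direct sums of loops and rank-one uniform matroids -/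

theorem isSmoothPolytope_disjointSigma {ι : Type*} (N : ι → Matroid α)
    (h : Pairwise (Function.onFun Disjoint fun i => (N i).E)) [(Matroid.disjointSigma N h).Finite]
    (hN : ∀ i, (N i).IsSingleLoop ∨ (N i).IsUniformOfRank 1) :
    IsSmoothPolytope (Matroid.disjointSigma N h).independencePolytope := by
  have hsubs : ∀ i I, (N i).Indep I → I.Subsingleton := by
    intro i I hI
    rcases hN i with ⟨e, he⟩ | hu
    · rw [he, loopyOn_indep_iff] at hI
      rw [hI]
      exact Set.subsingleton_empty
    · exact Set.encard_le_one_iff_subsingleton.1 (by simpa using ((hu.2 I).1 hI).2)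
  have huniq : ∀ {i j e}, e ∈ (N i).E → e ∈ (N j).E → i = j := by
    intro i j e hi hj
    by_contra hij
    exact Set.disjoint_left.1 (h hij) hi hj
  -- Labelling by the set of block indices avoids choosing an index: the label is a singleton on the
  -- ground set and empty off it.
  refine isSmoothPolytope_of_exchange (fun e ↦ {i | e ∈ (N i).E}) ?_ ?_
  · intro I hI e he f hf hef
    rw [disjointSigma_indep_iff] at hI
    obtain ⟨i, hi⟩ := Set.mem_iUnion.1 (hI.2 he)
    have hfi : i ∈ {i | f ∈ (N i).E} := hef ▸ hi
    exact hsubs i _ (hI.1 i) ⟨he, hi⟩ ⟨hf, hfi⟩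
  · intro I J s hI hJ
    rw [disjointSigma_indep_iff] at hI hJ ⊢
    refine ⟨fun j ↦ ?_, ?_⟩
    · have hs : ∀ e ∈ (N j).E, {i | e ∈ (N i).E} = {j} := fun e he ↦
        Set.ext fun i ↦ ⟨fun hi ↦ huniq hi he, fun hi ↦ by rw [hi]; exact he⟩
      by_cases hj : s = {j}
      · refine (hJ.1 j).subset ?_
        rintro e ⟨⟨-, he⟩ | ⟨hes, -⟩, hej⟩
        · exact ⟨he, hej⟩
        · exact absurd ((hs e hej).trans hj.symm) hes
      · refine (hI.1 j).subset ?_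
        rintro e ⟨⟨hes, -⟩ | ⟨-, he⟩, hej⟩
        · exact absurd (hes.symm.trans (hs e hej)) hj
        · exact ⟨he, hej⟩
    · rintro e (⟨-, he⟩ | ⟨-, he⟩)
      · exact hJ.2 he
      · exact hI.2 he

end Matroid

theorem mainTheorem1 {α : Type*} (M : Matroid α) [M.Finite] :
    IsSmoothPolytope M.independencePolytope ↔
      ∃ (k : ℕ) (N : Fin k → Matroid α)
        (h : Pairwise (Function.onFun Disjoint fun i => (N i).E)),
        M = Matroid.disjointSigma N h ∧
          ∀ i, (N i).IsSingleLoop ∨ (N i).IsUniformOfRank 1 := by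
  constructor
  · intro hM
    exact Matroid.exists_eq_disjointSigma_of_isCircuit_encard_le_two fun C hC ↦
      hC.encard_le_two_of_isSmoothPolytope hM
  · rintro ⟨k, N, h, rfl, hN⟩
    exact Matroid.isSmoothPolytope_disjointSigma N h hN
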